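/- Let $R$ be a commutative Noetherian ring with identity and $\mathfrak a$ an ideal of $R$. For $R$-modules $M$, $X$ and $i\ge 0$ put $H^i_{\mathfrak a}(M,X)=\varinjlim_n \operatorname{Ext}^i_R(M/\mathfrak a^nM,X)$ and $H^i_{\mathfrak a}(X)=\varinjlim_n \operatorname{Ext}^i_R(R/\mathfrak a^n,X)$. Let $\operatorname{pd}(M)$ denote the projective dimension of $M$ (with $\operatorname{pd}(0)=-\infty$), and let $\operatorname{cd}(\mathfrak a,X)$ denote the largest integer $i$ with $H^i_{\mathfrak a}(X)\neq 0$, understood as the supremum of all such $i$ (so it is $-\infty$ if there is none); a sum with a summand $-\infty$ is $-\infty$. Let $M$ be a finitely generated $R$-module with $\operatorname{pd}(M)<\infty$ and let $X$ be an arbitrary $R$-module. Then $$H^i_{\mathfrak a}(M,X)=0\quad\text{for all integers } i\ge 0 \text{ with } i>\operatorname{pd}(M)+\operatorname{cd}(\mathfrak a,X),$$ and, whenever $\operatorname{pd}(M)$ and $\operatorname{cd}(\mathfrak a,X)$ are non-negative integers, there is an isomorphism of $R$-modules $$H^{\operatorname{pd}(M)+\operatorname{cd}(\mathfrak a,X)}_{\mathfrak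 a}(M,X)\;\cong\;\operatorname{Ext}^{\operatorname{pd}(M)}_R\bigl(M,H^{\operatorname{cd}(\mathfrak a,X)}_{\mathfrak a}(X)\bigr).$$ -/

import Mathlib

open CategoryTheory

universe u

/-- The inverse system `⋯ → M/𝔞²M → M/𝔞M → M/𝔞⁰M`, with the canonical projections as
transition maps. -/
def quotientPowersDiagram {R : Type u} [CommRing R] (𝔞 : Ideal R) (M : ModuleCat.{u} R) :
    ℕᵒᵖ ⥤ ModuleCat.{u} R where
  obj t := ModuleCat.of R (M ⧸ (𝔞 ^ t.unop • ⊤ : Submodule R M))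
  map w := ModuleCat.ofHom <| Submodule.mapQ _ _ LinearMap.id
    (Submodule.smul_mono_left (Ideal.pow_le_pow_right w.unop.le))
  map_id _ := by
    ext x
    rfl
  map_comp _ _ := by
    ext x
    rfl

/-- The generalized local cohomology functor `Hⁱ_𝔞(M, -)`, that is, the direct limit over `n` of
`Extⁱ_R(M/𝔞ⁿM, -)`. -/
noncomputable def generalizedLocalCohomology {R : Type u} [CommRing R] (𝔞 : Ideal R) (i : ℕ)
    (M : ModuleCat.{u} R) : ModuleCat.{u} R ⥤ ModuleCat.{u} R :=
  Limits.colimit ((quotientPowersDiagram 𝔞 M).op ⋙ Ext R (ModuleCat.{u} R) i)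

/-- The cohomological dimension `cd(𝔞, X)`: the largest `i` such that the ordinary local cohomology
module `Hⁱ_𝔞(X)` is non-zero, as a supremum. It is `⊥` (minus infinity) if all of these modules
are zero. -/
noncomputable def cohomologicalDimension {R : Type u} [CommRing R] (𝔞 : Ideal R)
    (X : ModuleCat.{u} R) : WithBot ℕ∞ :=
  sSup {d : WithBot ℕ∞ | ∃ i : ℕ, d = i ∧ ¬ Limits.IsZero ((localCohomology 𝔞 i).obj X)}

-- Let `I` be an injective resolution of `X` and J = Γ_𝔞(I). Over a Noetherian ring, Γ_𝔞 preserves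
-- injectives (`Submodule.baer_powerTorsion`, by Artin–Rees), so J is a complex of injectives. A map
-- from a finitely generated M into Γ_𝔞(Iⁱ) is killed by some power 𝔞ⁿ, hence factors through M/𝔞ⁿM;
-- in the limit Hⁱ_𝔞(M, X) = Hⁱ(Hom(M, J)) (`colimitExtIso`). For M = R this says Hⁱ_𝔞(X) = Hⁱ(J),
-- so J is exact above c = cd(𝔞, X).
--
-- What remains concerns a complex J of injectives, exact above c, with cycles Z, boundaries B and
-- homology H. Dimension shifting along 0 → Zⁿ → Jⁿ → Zⁿ⁺¹ → 0 for n ≥ c gives Hⁿ(Hom(M, J)) ≅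
-- Extⁿ⁻ᶜ(M, Zᶜ) for n > c, which vanishes once n - c > p = pd(M). For n = p + c with p > 0, replace
-- Zᶜ by Hᶜ: since Bᶜ is a quotient of an injective, Extᵖ(M, Bᶜ) embeds in an Extᵖ⁺¹(M, -), which is
-- zero, and Extᵖ⁺¹(M, Bᶜ) = 0 as well. For p = 0, Hom(M, -) is exact and commutes with cohomology.
--
-- The statement uses the derived functor `_root_.Ext`, while the long exact sequences are those of
-- `Abelian.Ext`; the two are identified naturally in the first variable, so that the identification
-- is compatible with the direct limit.

universe w v

/-! ### Classes in `Abelian.Ext` represented by cocycles of resolutions. -/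

namespace CategoryTheory

open Limits Abelian

namespace ProjectiveResolution

variable {C : Type u} [Category.{v} C] [Abelian C] [HasExt.{w} C] {X Y : C}

/-- As a cochain complex, `P` lives in degrees ≤ 0, so a cocycle on `P.complex.X 0` has no nonzero
coboundary to differ by. -/
lemma eq_zero_of_extMk_eq_zero (P : ProjectiveResolution X) (f : P.complex.X 0 ⟶ Y) (m : ℕ)
    (hm : 0 + 1 = m) (hf : P.complex.d m 0 ≫ f = 0) (h : P.extMk f m hm hf = 0) : f = 0 := by
  rw [← P.extEquivCohomologyClass.apply_eq_iff_eq, extEquivCohomologyClass_extMk,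
    extEquivCohomologyClass_zero,
    CochainComplex.HomComplex.CohomologyClass.mk_eq_zero_iff,
    CochainComplex.HomComplex.Cocycle.toSingleMk_mem_coboundaries_iff _ _ _ _ _ 1 (by simp)] at h
  obtain ⟨g, hg⟩ := h
  have h0 : IsZero (P.cochainComplex.X 1) :=
    CochainComplex.isZero_of_isStrictlyLE _ 0 _ (by simp)
  rw [h0.eq_of_src g 0, comp_zero] at hg
  rw [← cancel_epi (P.cochainComplexXIso (-(0 : ℕ)) 0 rfl).hom, ← hg, comp_zero]

/-- The index `next n` makes the criterion uniform in n: for n = 0 it is 0 itself and the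
differential is zero, so only f = 0 is a coboundary. -/
lemma extMk_eq_zero_iff_exists_next (P : ProjectiveResolution X) {n : ℕ} (f : P.complex.X n ⟶ Y)
    (m : ℕ) (hm : n + 1 = m) (hf : P.complex.d m n ≫ f = 0) :
    P.extMk f m hm hf = 0 ↔ ∃ g : P.complex.X ((ComplexShape.down ℕ).next n) ⟶ Y,
      P.complex.d n ((ComplexShape.down ℕ).next n) ≫ g = f := by
  cases n with
  | zero =>
    rw [P.complex.shape _ _ (by simp)]
    refine ⟨fun h ↦ ⟨0, ?_⟩, fun ⟨g, hg⟩ ↦ ?_⟩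
    · rw [P.eq_zero_of_extMk_eq_zero f m hm hf h, comp_zero]
    · obtain rfl : f = 0 := by rw [← hg, zero_comp]
      simp
  | succ n =>
    rw [ChainComplex.next_nat_succ]
    exact P.extMk_eq_zero_iff f m hm hf n rfl

variable {R : Type*} [Ring R] [Linear R C]

lemma smul_extMk (P : ProjectiveResolution X) {n : ℕ} (f : P.complex.X n ⟶ Y) (m : ℕ)
    (hm : n + 1 = m) (hf : P.complex.d m n ≫ f = 0) (r : R) :
    r • P.extMk f m hm hf = P.extMk (r • f) m hm (by rw [Linear.comp_smul, hf, smul_zero]) := by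
  rw [Ext.smul_eq_comp_mk₀, extMk_comp_mk₀]
  congr 1
  simp

end ProjectiveResolution

namespace InjectiveResolution

variable {C : Type u} [Category.{v} C] [Abelian C] [HasExt.{w} C] {X Y : C}

lemma eq_zero_of_extMk_eq_zero (I : InjectiveResolution Y) (f : X ⟶ I.cocomplex.X 0) (m : ℕ)
    (hm : 0 + 1 = m) (hf : f ≫ I.cocomplex.d 0 m = 0) (h : I.extMk f m hm hf = 0) : f = 0 := by
  rw [← I.extEquivCohomologyClass.apply_eq_iff_eq, extEquivCohomologyClass_extMk,
    extEquivCohomologyClass_zero,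
    CochainComplex.HomComplex.CohomologyClass.mk_eq_zero_iff,
    CochainComplex.HomComplex.Cocycle.fromSingleMk_mem_coboundaries_iff _ _ _ _ _ (-1)
      (by simp)] at h
  obtain ⟨g, hg⟩ := h
  have h0 : IsZero (I.cochainComplex.X (-1)) :=
    CochainComplex.isZero_of_isStrictlyGE _ 0 _ (by simp)
  rw [h0.eq_of_tgt g 0, zero_comp] at hg
  rw [← cancel_mono (I.cochainComplexXIso (0 : ℕ) 0 rfl).inv, ← hg, zero_comp]

lemma extMk_eq_zero_iff_exists_prev (I : InjectiveResolution Y) {n : ℕ}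
    (f : X ⟶ I.cocomplex.X n) (m : ℕ) (hm : n + 1 = m) (hf : f ≫ I.cocomplex.d n m = 0) :
    I.extMk f m hm hf = 0 ↔ ∃ g : X ⟶ I.cocomplex.X ((ComplexShape.up ℕ).prev n),
      g ≫ I.cocomplex.d ((ComplexShape.up ℕ).prev n) n = f := by
  cases n with
  | zero =>
    rw [I.cocomplex.shape _ _ (by simp)]
    refine ⟨fun h ↦ ⟨0, ?_⟩, fun ⟨g, hg⟩ ↦ ?_⟩
    · rw [I.eq_zero_of_extMk_eq_zero f m hm hf h, zero_comp]
    · obtain rfl : f = 0 := by rw [← hg, comp_zero]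
      simp
  | succ n =>
    rw [CochainComplex.prev_nat_succ]
    exact I.extMk_eq_zero_iff f m hm hf n rfl

variable {R : Type*} [Ring R] [Linear R C]

lemma smul_extMk (I : InjectiveResolution Y) {n : ℕ} (f : X ⟶ I.cocomplex.X n) (m : ℕ)
    (hm : n + 1 = m) (hf : f ≫ I.cocomplex.d n m = 0) (r : R) :
    r • I.extMk f m hm hf = I.extMk (r • f) m hm (by rw [Linear.smul_comp, hf, smul_zero]) := by
  have : r • I.extMk f m hm hf = (Ext.mk₀ (r • 𝟙 X)).comp (I.extMk f m hm hf) (zero_add _) := by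
    rw [Ext.mk₀_smul, Ext.smul_comp, Ext.mk₀_id_comp]
  rw [this, mk₀_comp_extMk]
  congr 1
  simp

end InjectiveResolution

/-! ### The derived functor `_root_.Ext` agrees with `Abelian.Ext`, naturally in the first variable.
-/

section ExtComparison

variable {C : Type u} [Category.{v} C] [Abelian C] {X Y : C}
  {R : Type*} [CommRing R] [Linear R C]

namespace ProjectiveResolution

/-- The cocycles of degree `n` in `Hom(P, Y)`. -/
def cocycles (P : ProjectiveResolution X) (R : Type*) [CommRing R] [Linear R C] (Y : C) (n : ℕ) :
    Submodule R (P.complex.X n ⟶ Y) :=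
  LinearMap.ker (Linear.leftComp R Y (P.complex.d (n + 1) n))

/-- The inclusion of the cycles of the complex `Hom(P, Y)`. -/
noncomputable def cyclesToCocycles (P : ProjectiveResolution X) (R : Type*) [CommRing R]
    [Linear R C] (Y : C) (n : ℕ) :
    (P.complex.linearYonedaObj R Y).cycles n →ₗ[R] P.cocycles R Y n :=
  LinearMap.codRestrict _ ((P.complex.linearYonedaObj R Y).iCycles n).hom fun z ↦
    ConcreteCategory.congr_hom ((P.complex.linearYonedaObj R Y).iCycles_d n (n + 1)) z

lemma cyclesToCocycles_surjective (P : ProjectiveResolution X) (n : ℕ) :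
    Function.Surjective (P.cyclesToCocycles R Y n) := by
  intro z
  let K := P.complex.linearYonedaObj R Y
  let k : ModuleCat.of R (P.cocycles R Y n) ⟶ K.X n := ModuleCat.ofHom (Submodule.subtype _)
  have hk : k ≫ K.d n (n + 1) = 0 := by
    ext x
    exact x.2
  refine ⟨K.liftCycles k (n + 1) (by simp) hk z, ?_⟩
  apply Subtype.ext
  exact ConcreteCategory.congr_hom (K.liftCycles_i k (n + 1) (by simp) hk) z

/-- The morphism `Hom(Q, Y) ⟶ Hom(P, Y)` induced by a chain map `P ⟶ Q`. -/
noncomputable def _root_.ChainComplex.linearYonedaMap {P Q : ChainComplex C ℕ} (φ : P ⟶ Q)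
    (R : Type*) [Ring R] [Linear R C] (Y : C) :
    Q.linearYonedaObj R Y ⟶ P.linearYonedaObj R Y :=
  (HomologicalComplex.unopFunctor _ _).map
    ((((linearYoneda R C).obj Y).rightOp.mapHomologicalComplex _).map φ).op

/-- `_root_.Ext` is an opposite of a left derived functor; the square pastes the naturality of
`isoLeftDerivedObj` and that of the passage of homology to the opposite category. -/
lemma isoExt_hom_naturality [EnoughProjectives C] {X' : C} {g : X' ⟶ X}
    {P' : ProjectiveResolution X'} {P : ProjectiveResolution X} (φ : Hom P' P g) (n : ℕ) :
    ((_root_.Ext R C n).map g.op).app Y ≫ (P'.isoExt n Y).hom =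
      (P.isoExt n Y).hom ≫
        HomologicalComplex.homologyMap (ChainComplex.linearYonedaMap φ.hom R Y) n := by
  have h1 := ProjectiveResolution.isoLeftDerivedObj_inv_naturality g P' P φ.hom
    (by simpa using φ.hom_f_zero_comp_π_f_zero) ((linearYoneda R C).obj Y).rightOp n
  have h2 := ShortComplex.homologyOpIso_inv_naturality
    ((HomologicalComplex.shortComplexFunctor _ (ComplexShape.up ℕ) n).map
      (ChainComplex.linearYonedaMap φ.hom R Y))
  have h1' : ((_root_.Ext R C n).map g.op).app Y ≫ (P'.isoLeftDerivedObj _ n).inv.unop = _ :=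
    congrArg Quiver.Hom.unop h1
  have h2' := (congrArg Quiver.Hom.unop h2).symm
  exact (Category.assoc _ _ _).symm.trans ((congrArg (· ≫ _) h1').trans
    ((Category.assoc _ _ _).trans ((congrArg (_ ≫ ·) h2').trans (Category.assoc _ _ _).symm)))

variable [HasExt.{v} C]

/-- The linear map sending a cocycle of `Hom(P, Y)` to the class which it represents. -/
noncomputable def cocyclesToExt (P : ProjectiveResolution X) (R : Type*) [CommRing R] [Linear R C]
    (Y : C) (n : ℕ) : P.cocycles R Y n →ₗ[R] Ext X Y n where
  toFun z := P.extMk z.1 (n + 1) rfl z.2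
  map_add' _ _ := (P.add_extMk _ _ _ _ _ _).symm
  map_smul' r z := (P.smul_extMk _ _ _ z.2 r).symm

/-- The map sending a cycle of `Hom(P, Y)` to the class in `Ext` which it represents. -/
noncomputable def cyclesToExt (P : ProjectiveResolution X) (R : Type*) [CommRing R]
    [Linear R C] (Y : C) (n : ℕ) :
    (P.complex.linearYonedaObj R Y).cycles n ⟶ ModuleCat.of R (Ext X Y n) :=
  ModuleCat.ofHom (P.cocyclesToExt R Y n ∘ₗ P.cyclesToCocycles R Y n)

lemma cyclesToExt_surjective (P : ProjectiveResolution X) (n : ℕ) :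
    Function.Surjective (P.cyclesToExt R Y n) := by
  intro e
  obtain ⟨f, hf, rfl⟩ := P.extMk_surjective e (n + 1) rfl
  obtain ⟨z, hz⟩ := P.cyclesToCocycles_surjective (R := R) n ⟨f, hf⟩
  refine ⟨z, ?_⟩
  change P.cocyclesToExt R Y n (P.cyclesToCocycles R Y n z) = _
  rw [hz]
  rfl

lemma cyclesToExt_eq_zero_iff (P : ProjectiveResolution X) (n : ℕ)
    (z : (P.complex.linearYonedaObj R Y).cycles n) :
    P.cyclesToExt R Y n z = 0 ↔ (P.complex.linearYonedaObj R Y).homologyπ n z = 0 := by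
  let K := P.complex.linearYonedaObj R Y
  have h1 := P.extMk_eq_zero_iff_exists_next (P.cyclesToCocycles R Y n z).1 (n + 1) rfl
    (P.cyclesToCocycles R Y n z).2
  -- Homology is the cokernel of `toCycles`, so both sides become "is a coboundary".
  have h2 : K.homologyπ n z = 0 ↔
      ∃ g, K.toCycles ((ComplexShape.up ℕ).prev n) n g = z := by
    have hex : (ShortComplex.mk _ _ (K.toCycles_comp_homologyπ
        ((ComplexShape.up ℕ).prev n) n)).Exact :=
      ShortComplex.exact_of_g_is_cokernel _ (K.homologyIsCokernel _ n rfl)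
    rw [ShortComplex.moduleCat_exact_iff] at hex
    refine ⟨fun h ↦ hex z h, ?_⟩
    rintro ⟨g, rfl⟩
    exact ConcreteCategory.congr_hom (K.toCycles_comp_homologyπ _ n) g
  refine h1.trans (Iff.trans ?_ h2.symm)
  refine exists_congr fun g ↦ ?_
  have hi : Function.Injective (K.iCycles n) := (ModuleCat.mono_iff_injective _).1 inferInstance
  rw [← hi.eq_iff]
  have : K.iCycles n (K.toCycles ((ComplexShape.up ℕ).prev n) n g) = K.d _ n g :=
    ConcreteCategory.congr_hom (K.toCycles_i _ n) g
  rw [this]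
  rfl

/-- The homology of `Hom(P, Y)` is `Ext`. -/
noncomputable def homologyIsoExt (P : ProjectiveResolution X) (R : Type*) [CommRing R]
    [Linear R C] (Y : C) (n : ℕ) :
    (P.complex.linearYonedaObj R Y).homology n ≅ ModuleCat.of R (Ext X Y n) :=
  have w : (P.complex.linearYonedaObj R Y).toCycles ((ComplexShape.up ℕ).prev n) n ≫
      P.cyclesToExt R Y n = 0 := by
    ext g
    refine (P.cyclesToExt_eq_zero_iff n _).2 ?_
    exact ConcreteCategory.congr_hom
      ((P.complex.linearYonedaObj R Y).toCycles_comp_homologyπ _ n) g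
  let φ : (P.complex.linearYonedaObj R Y).homology n ⟶ ModuleCat.of R (Ext X Y n) :=
    ((P.complex.linearYonedaObj R Y).homologyIsCokernel _ n rfl).desc (CokernelCofork.ofπ _ w)
  have hφ : Function.Bijective φ := by
    have hπ (z) : φ ((P.complex.linearYonedaObj R Y).homologyπ n z) = P.cyclesToExt R Y n z :=
      ConcreteCategory.congr_hom
        (((P.complex.linearYonedaObj R Y).homologyIsCokernel _ n rfl).fac
          (CokernelCofork.ofπ _ w) WalkingParallelPair.one) z
    have hs : Function.Surjective ((P.complex.linearYonedaObj R Y).homologyπ n) :=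
      (ModuleCat.epi_iff_surjective _).1 inferInstance
    constructor
    · refine (injective_iff_map_eq_zero φ.hom).2 fun x hx ↦ ?_
      obtain ⟨z, rfl⟩ := hs x
      exact (P.cyclesToExt_eq_zero_iff n z).1 ((hπ z).symm.trans hx)
    · intro e
      obtain ⟨z, rfl⟩ := P.cyclesToExt_surjective n e
      exact ⟨_, hπ z⟩
  have : IsIso φ := (ConcreteCategory.isIso_iff_bijective φ).2 hφ
  asIso φ

lemma homologyπ_homologyIsoExt_hom (P : ProjectiveResolution X) (n : ℕ) :
    (P.complex.linearYonedaObj R Y).homologyπ n ≫ (P.homologyIsoExt R Y n).hom =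
      P.cyclesToExt R Y n :=
  ((P.complex.linearYonedaObj R Y).homologyIsCokernel _ n rfl).fac
    _ WalkingParallelPair.one

lemma homologyMap_linearYonedaMap_homologyIsoExt_hom {X' : C} {g : X' ⟶ X}
    {P' : ProjectiveResolution X'} {P : ProjectiveResolution X} (φ : Hom P' P g) (n : ℕ) :
    HomologicalComplex.homologyMap (ChainComplex.linearYonedaMap φ.hom R Y) n ≫
        (P'.homologyIsoExt R Y n).hom =
      (P.homologyIsoExt R Y n).hom ≫
        ModuleCat.ofHom ((Ext.mk₀ g).precompOfLinear R Y (zero_add n)) := by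
  rw [← cancel_epi ((P.complex.linearYonedaObj R Y).homologyπ n),
    HomologicalComplex.homologyπ_naturality_assoc, homologyπ_homologyIsoExt_hom,
    reassoc_of% P.homologyπ_homologyIsoExt_hom]
  ext z
  refine Eq.trans ?_ (mk₀_comp_extMk (P.cyclesToCocycles R Y n z).1 (n + 1) rfl
    (P.cyclesToCocycles R Y n z).2 φ).symm
  have h : (P'.cyclesToCocycles R Y n
      (HomologicalComplex.cyclesMap (ChainComplex.linearYonedaMap φ.hom R Y) n z)).1 =
      φ.hom.f n ≫ (P.cyclesToCocycles R Y n z).1 :=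
    ConcreteCategory.congr_hom (HomologicalComplex.cyclesMap_i
      (ChainComplex.linearYonedaMap φ.hom R Y) n) z
  change P'.cocyclesToExt R Y n _ =
    P'.cocyclesToExt R Y n ⟨_, h ▸ (P'.cyclesToCocycles R Y n _).2⟩
  exact congrArg _ (Subtype.ext h)

end ProjectiveResolution

variable [HasExt.{v} C] [EnoughProjectives C]

/-- The functor `Ext` obtained from projective resolutions is given by the `Ext`-modules which
are defined by means of the derived category. -/
noncomputable def extObjIso (R : Type*) [CommRing R] [Linear R C] (X Y : C) (n : ℕ) :
    ((_root_.Ext R C n).obj (Opposite.op X)).obj Y ≅ ModuleCat.of R (Ext X Y n) :=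
  (projectiveResolution X).isoExt n Y ≪≫ (projectiveResolution X).homologyIsoExt R Y n

lemma extObjIso_hom_naturality {X' X : C} (g : X' ⟶ X) (Y : C) (n : ℕ) :
    ((_root_.Ext R C n).map g.op).app Y ≫ (extObjIso R X' Y n).hom =
      (extObjIso R X Y n).hom ≫
        ModuleCat.ofHom ((Ext.mk₀ g).precompOfLinear R Y (zero_add n)) := by
  let φ : ProjectiveResolution.Hom (projectiveResolution X') (projectiveResolution X) g :=
    { hom := ProjectiveResolution.lift g _ _
      hom_f_zero_comp_π_f_zero := (ProjectiveResolution.lift_commutes_zero g _ _).trans (by simp) }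
  have h1 := ProjectiveResolution.isoExt_hom_naturality (R := R) (Y := Y) φ n
  have h2 := ProjectiveResolution.homologyMap_linearYonedaMap_homologyIsoExt_hom
    (R := R) (Y := Y) φ n
  rw [extObjIso, extObjIso, Iso.trans_hom, Iso.trans_hom, Category.assoc, ← h2,
    ← Category.assoc, h1, Category.assoc]

end ExtComparison

end CategoryTheory

/-! ### Cohomology of Hom(M, J), and `Ext` from injective resolutions. -/

namespace CategoryTheory

open Limits Abelian

section HomCohomology

variable (R : Type*) [CommRing R] {C : Type u} [Category.{v} C] [Abelian C] [Linear R C]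

/-- The cocycles of degree `n` in the complex `Hom(M, J)`. -/
def homCocycles (M : C) (J : CochainComplex C ℕ) (n : ℕ) : Submodule R (M ⟶ J.X n) :=
  LinearMap.ker (Linear.rightComp R M (J.d n (n + 1)))

/-- The coboundaries of degree `n` in the complex `Hom(M, J)`. -/
noncomputable def homCoboundaries (M : C) (J : CochainComplex C ℕ) (n : ℕ) :
    Submodule R (M ⟶ J.X n) :=
  LinearMap.range (Linear.rightComp R M (J.d ((ComplexShape.up ℕ).prev n) n))

/-- The cohomology of the complex `Hom(M, J)`. -/
abbrev HomCohomology (M : C) (J : CochainComplex C ℕ) (n : ℕ) : Type _ :=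
  homCocycles R M J n ⧸ (homCoboundaries R M J n).submoduleOf (homCocycles R M J n)

variable {R}

lemma mem_homCocycles {M : C} {J : CochainComplex C ℕ} {n : ℕ} (f : M ⟶ J.X n) :
    f ∈ homCocycles R M J n ↔ f ≫ J.d n (n + 1) = 0 := Iff.rfl

lemma HomCohomology.mk_eq_zero {M : C} {J : CochainComplex C ℕ} {n : ℕ}
    (f : homCocycles R M J n) :
    (Submodule.Quotient.mk f : HomCohomology R M J n) = 0 ↔
      ∃ g, g ≫ J.d ((ComplexShape.up ℕ).prev n) n = f.1 :=
  Submodule.Quotient.mk_eq_zero _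

/-- The cocycle of an injective resolution gives a class in `Ext`. -/
noncomputable def InjectiveResolution.cocyclesToExt [HasExt.{w} C] {Y : C}
    (I : InjectiveResolution Y) (R : Type*) [CommRing R] [Linear R C] (X : C) (n : ℕ) :
    homCocycles R X I.cocomplex n →ₗ[R] Ext X Y n where
  toFun z := I.extMk z.1 (n + 1) rfl z.2
  map_add' _ _ := (I.add_extMk _ _ _ _ _ _).symm
  map_smul' r z := (I.smul_extMk _ _ _ z.2 r).symm

/-- `Ext` is the cohomology of `Hom(X, I)` for an injective resolution `I`. -/
noncomputable def InjectiveResolution.homCohomologyEquivExt [HasExt.{w} C] {Y : C}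
    (I : InjectiveResolution Y) (R : Type*) [CommRing R] [Linear R C] (X : C) (n : ℕ) :
    HomCohomology R X I.cocomplex n ≃ₗ[R] Ext X Y n :=
  have hz (z : homCocycles R X I.cocomplex n) : I.cocyclesToExt R X n z = 0 ↔
      (Submodule.Quotient.mk z : HomCohomology R X I.cocomplex n) = 0 := by
    rw [HomCohomology.mk_eq_zero]
    exact I.extMk_eq_zero_iff_exists_prev z.1 (n + 1) rfl z.2
  LinearEquiv.ofBijective
    (Submodule.liftQ _ (I.cocyclesToExt R X n) fun z hz' ↦
      (hz z).2 ((Submodule.Quotient.mk_eq_zero _).2 hz')) (by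
    constructor
    · refine (injective_iff_map_eq_zero _).2 fun x hx ↦ ?_
      obtain ⟨z, rfl⟩ := Submodule.Quotient.mk_surjective _ x
      exact (hz z).1 hx
    · intro e
      obtain ⟨f, hf, rfl⟩ := I.extMk_surjective e (n + 1) rfl
      exact ⟨Submodule.Quotient.mk ⟨f, hf⟩, rfl⟩)

/-- Precomposition on the cohomology of `Hom(-, J)`. -/
noncomputable def HomCohomology.precomp {X' X : C} (g : X' ⟶ X) (J : CochainComplex C ℕ) (n : ℕ) :
    HomCohomology R X J n →ₗ[R] HomCohomology R X' J n :=
  Submodule.mapQ _ _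
    ((Linear.leftComp R (J.X n) g).restrict (p := homCocycles R X J n) (q := homCocycles R X' J n)
      fun f hf ↦ by
        rw [mem_homCocycles] at hf
        rw [mem_homCocycles, Linear.leftComp_apply, Category.assoc, hf, comp_zero])
    (by
      rintro ⟨f, hf⟩ ⟨k, hk⟩
      exact ⟨g ≫ k, (Category.assoc _ _ _).trans (congrArg (g ≫ ·) hk)⟩)

lemma InjectiveResolution.homCohomologyEquivExt_precomp [HasExt.{w} C] {X' X Y : C}
    (I : InjectiveResolution Y) (g : X' ⟶ X) (n : ℕ) (x : HomCohomology R X I.cocomplex n) :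
    I.homCohomologyEquivExt R X' n (HomCohomology.precomp g _ n x) =
      (Ext.mk₀ g).comp (I.homCohomologyEquivExt R X n x) (zero_add n) := by
  obtain ⟨z, rfl⟩ := Submodule.Quotient.mk_surjective _ x
  exact (I.mk₀_comp_extMk z.1 (n + 1) rfl z.2 g).symm


end HomCohomology

end CategoryTheory

/-! ### Power torsion and its preservation of injectivity. -/

namespace Submodule

variable {R : Type u} [CommRing R] (𝔞 : Ideal R)

/-- The submodule of the elements which are annihilated by some power of `𝔞`. -/
def powerTorsion (N : Type*) [AddCommGroup N] [Module R N] : Submodule R N where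
  carrier := {x | ∃ n : ℕ, ∀ r ∈ 𝔞 ^ n, r • x = 0}
  zero_mem' := ⟨0, fun _ _ ↦ smul_zero _⟩
  add_mem' := by
    rintro x y ⟨m, hm⟩ ⟨n, hn⟩
    refine ⟨max m n, fun r hr ↦ ?_⟩
    rw [smul_add, hm r (Ideal.pow_le_pow_right (le_max_left _ _) hr),
      hn r (Ideal.pow_le_pow_right (le_max_right _ _) hr), add_zero]
  smul_mem' := by
    rintro s x ⟨n, hn⟩
    exact ⟨n, fun r hr ↦ by rw [smul_comm, hn r hr, smul_zero]⟩

variable {𝔞} {N : Type u} [AddCommGroup N] [Module R N]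

/-- Each of finitely many generators is sent to an element killed by some power of 𝔞; the largest
exponent works for all of M. -/
lemma exists_pow_smul_eq_zero_of_finite {M : Type*} [AddCommGroup M] [Module R M]
    [Module.Finite R M] (f : M →ₗ[R] N) (hf : ∀ x, f x ∈ powerTorsion 𝔞 N) :
    ∃ n : ℕ, 𝔞 ^ n • (⊤ : Submodule R M) ≤ LinearMap.ker f := by
  obtain ⟨s, hs⟩ := Module.Finite.fg_top (R := R) (M := M)
  choose k hk using hf
  refine ⟨s.sup k, smul_le.2 fun r hr x _ ↦ ?_⟩
  have hle : (⊤ : Submodule R M) ≤ LinearMap.ker (r • f) := by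
    rw [← hs, span_le]
    intro y hy
    exact hk y r (Ideal.pow_le_pow_right (Finset.le_sup hy) hr)
  have := hle (mem_top (x := x))
  rwa [LinearMap.mem_ker, map_smul]

/-- The submodule of elements annihilated by a power of an ideal in an injective module over a
Noetherian ring satisfies Baer's criterion. -/
lemma baer_powerTorsion [IsNoetherianRing R] (hN : Module.Baer R N) :
    Module.Baer R (powerTorsion 𝔞 N) := by
  intro 𝔟 g
  obtain ⟨n, hn⟩ := exists_pow_smul_eq_zero_of_finite
    ((powerTorsion 𝔞 N).subtype ∘ₗ g) fun x ↦ (g x).2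
  -- Artin–Rees: 𝔞ⁿ⁺ᵏ ∩ 𝔟 ⊆ 𝔞ⁿ𝔟, on which g vanishes. Hence g factors through the image of 𝔟 in
  -- R/𝔞ⁿ⁺ᵏ.
  obtain ⟨k, hk⟩ := Ideal.exists_pow_inf_eq_pow_smul 𝔞 (𝔟 : Submodule R R)
  have hint : 𝔞 ^ (n + k) ⊓ 𝔟 ≤ 𝔞 ^ n • 𝔟 := by
    have h := hk (n + k) (Nat.le_add_left _ _)
    rw [Nat.add_sub_cancel, smul_eq_mul, Ideal.mul_top] at h
    rw [h]
    exact smul_mono_right _ inf_le_right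
  have hg (x : 𝔟) (hx : (x : R) ∈ 𝔞 ^ (n + k)) : g x = 0 := by
    have h1 : (x : R) ∈ 𝔞 ^ n • 𝔟 := hint ⟨hx, x.2⟩
    have h2 : x ∈ 𝔞 ^ n • (⊤ : Submodule R 𝔟) := by
      have h3 : (𝔟 : Submodule R R).subtype x ∈ map (𝔟 : Submodule R R).subtype (𝔞 ^ n • ⊤) := by
        rw [map_smul'', map_top, range_subtype]
        exact h1
      obtain ⟨y, hy, hyx⟩ := h3
      rwa [← Subtype.ext hyx]
    exact Subtype.ext (hn h2)
  let φ : 𝔟 →ₗ[R] R ⧸ 𝔞 ^ (n + k) := (𝔞 ^ (n + k)).mkQ ∘ₗ (𝔟 : Submodule R R).subtype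
  have hφ (x : 𝔟) (hx : φ x = 0) : (x : R) ∈ 𝔞 ^ (n + k) :=
    (Submodule.Quotient.mk_eq_zero _).1 hx
  -- Extending over R/𝔞ⁿ⁺ᵏ rather than R forces the values of the extension to be killed by 𝔞ⁿ⁺ᵏ, so
  -- they lie in the torsion submodule.
  obtain ⟨h, hh⟩ := hN.injective.out ((LinearMap.ker φ).liftQ φ le_rfl)
    (LinearMap.ker_eq_bot.1 (ker_liftQ_eq_bot _ _ _ le_rfl))
    ((LinearMap.ker φ).liftQ ((powerTorsion 𝔞 N).subtype ∘ₗ g) fun x hx ↦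
      congrArg Subtype.val (hg x (hφ x hx)))
  refine ⟨LinearMap.codRestrict _ (h ∘ₗ (𝔞 ^ (n + k)).mkQ) fun s ↦ ⟨n + k, fun r hr ↦ ?_⟩,
    fun x hx ↦ Subtype.ext (hh (Submodule.Quotient.mk ⟨x, hx⟩))⟩
  rw [← map_smul]
  have : (𝔞 ^ (n + k)).mkQ (r • s) = 0 :=
    (Submodule.Quotient.mk_eq_zero _).2 (Ideal.mul_mem_right _ _ hr)
  rw [LinearMap.comp_apply, this, map_zero]

end Submodule

namespace ModuleCat

open Limits

variable {R : Type u} [CommRing R] (𝔞 : Ideal R)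

/-- The functor `Γ_𝔞` of sections supported at an ideal `𝔞`. -/
def powerTorsionFunctor : ModuleCat.{u} R ⥤ ModuleCat.{u} R where
  obj N := ModuleCat.of R (Submodule.powerTorsion 𝔞 N)
  map {N N'} f := ModuleCat.ofHom <| f.hom.restrict (p := Submodule.powerTorsion 𝔞 N)
    (q := Submodule.powerTorsion 𝔞 N') fun x ⟨n, hn⟩ ↦
      ⟨n, fun r hr ↦ by rw [← map_smul, hn r hr, map_zero]⟩

instance : (powerTorsionFunctor 𝔞).Additive where

/-- The inclusion of `Γ_𝔞(N)` into `N`. -/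
def powerTorsionι : powerTorsionFunctor 𝔞 ⟶ 𝟭 (ModuleCat.{u} R) where
  app N := ModuleCat.ofHom (Submodule.powerTorsion 𝔞 N).subtype

instance (N : ModuleCat.{u} R) : Mono ((powerTorsionι 𝔞).app N) :=
  (ModuleCat.mono_iff_injective _).2 (Submodule.powerTorsion 𝔞 N).injective_subtype

instance [IsNoetherianRing R] (N : ModuleCat.{u} R) [Injective N] :
    Injective ((powerTorsionFunctor 𝔞).obj N) := by
  have h : Module.Injective R N := Module.injective_module_of_injective_object R N
  have := (Submodule.baer_powerTorsion (𝔞 := 𝔞) (Module.Baer.of_injective h)).injective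
  exact Module.injective_object_of_injective_module R (Submodule.powerTorsion 𝔞 N)

/-- A morphism with values in `N` whose image is annihilated by a power of `𝔞`, as a morphism with
values in `Γ_𝔞(N)`. -/
def powerTorsionLift {M N : ModuleCat.{u} R} (f : M ⟶ N)
    (hf : ∃ n : ℕ, 𝔞 ^ n • (⊤ : Submodule R M) ≤ LinearMap.ker f.hom) :
    M ⟶ (powerTorsionFunctor 𝔞).obj N :=
  ModuleCat.ofHom <| f.hom.codRestrict (Submodule.powerTorsion 𝔞 N) fun x ↦ by
    obtain ⟨n, hn⟩ := hf
    exact ⟨n, fun r hr ↦ (f.hom.map_smul r x).symm.trans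
      (hn (Submodule.smul_mem_smul hr Submodule.mem_top))⟩

variable {𝔞}

lemma exists_pow_smul_le_ker {M N : ModuleCat.{u} R} [Module.Finite R M]
    (f : M ⟶ (powerTorsionFunctor 𝔞).obj N) :
    ∃ n : ℕ, 𝔞 ^ n • (⊤ : Submodule R M) ≤
      LinearMap.ker (f ≫ (powerTorsionι 𝔞).app N).hom :=
  Submodule.exists_pow_smul_eq_zero_of_finite (f ≫ (powerTorsionι 𝔞).app N).hom
    fun x ↦ (f.hom x).2

/-- A morphism which vanishes on the kernel of an epimorphism factors through it. -/
lemma exists_fac_of_ker_le {M N P : ModuleCat.{u} R} (π : M ⟶ P) [Epi π] (f : M ⟶ N)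
    (h : LinearMap.ker π.hom ≤ LinearMap.ker f.hom) : ∃ g : P ⟶ N, π ≫ g = f := by
  have hs : Function.Surjective π.hom := (ModuleCat.epi_iff_surjective π).1 inferInstance
  let e := π.hom.quotKerEquivOfSurjective hs
  refine ⟨ModuleCat.ofHom ((LinearMap.ker π.hom).liftQ f.hom h ∘ₗ e.symm.toLinearMap), ?_⟩
  ext x
  have : e.symm (π.hom x) = Submodule.Quotient.mk x := by
    rw [LinearEquiv.symm_apply_eq]
    rfl
  change (LinearMap.ker π.hom).liftQ f.hom h (e.symm (π.hom x)) = _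
  rw [this]
  rfl

end ModuleCat

/-! ### The direct limit of `Ext` as the cohomology of Hom(M, Γ_𝔞(I)). -/

namespace ModuleCat

open Limits Abelian Opposite

variable {R : Type u} [CommRing R] (𝔞 : Ideal R)

/-- The functor `Γ_𝔞` on cochain complexes. -/
noncomputable abbrev powerTorsionComplex (K : CochainComplex (ModuleCat.{u} R) ℕ) :
    CochainComplex (ModuleCat.{u} R) ℕ :=
  ((powerTorsionFunctor 𝔞).mapHomologicalComplex _).obj K

variable {𝔞}

lemma pow_smul_le_ker_comp {M P Q : ModuleCat.{u} R} {π : M ⟶ P}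
    (hπ : ∃ n : ℕ, 𝔞 ^ n • (⊤ : Submodule R M) ≤ LinearMap.ker π.hom) (f : P ⟶ Q) :
    ∃ n : ℕ, 𝔞 ^ n • (⊤ : Submodule R M) ≤ LinearMap.ker (π ≫ f).hom := by
  obtain ⟨n, hn⟩ := hπ
  exact ⟨n, hn.trans (LinearMap.ker_le_ker_comp _ _)⟩

/-- If `π : M ⟶ P` is annihilated by a power of `𝔞`, precomposition with `π` sends cocycles of
`Hom(P, K)` to cocycles of `Hom(M, Γ_𝔞(K))`. -/
noncomputable def cocyclesToPowerTorsion {M P : ModuleCat.{u} R} (π : M ⟶ P)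
    (hπ : ∃ n : ℕ, 𝔞 ^ n • (⊤ : Submodule R M) ≤ LinearMap.ker π.hom)
    (K : CochainComplex (ModuleCat.{u} R) ℕ) (i : ℕ) :
    homCocycles R P K i →ₗ[R] homCocycles R M (powerTorsionComplex 𝔞 K) i where
  toFun f := ⟨powerTorsionLift 𝔞 (π ≫ f.1) (pow_smul_le_ker_comp hπ _), by
    have h : π ≫ f.1 ≫ K.d i (i + 1) = 0 := by rw [(mem_homCocycles _).1 f.2, comp_zero]
    exact (cancel_mono ((powerTorsionι 𝔞).app (K.X (i + 1)))).1 h⟩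
  map_add' _ _ := rfl
  map_smul' _ _ := rfl

/-- The map `H(Hom(P, K)) ⟶ H(Hom(M, Γ_𝔞(K)))` given by a morphism `π : M ⟶ P` which is
annihilated by a power of `𝔞`. -/
noncomputable def homCohomologyToPowerTorsion {M P : ModuleCat.{u} R} (π : M ⟶ P)
    (hπ : ∃ n : ℕ, 𝔞 ^ n • (⊤ : Submodule R M) ≤ LinearMap.ker π.hom)
    (K : CochainComplex (ModuleCat.{u} R) ℕ) (i : ℕ) :
    HomCohomology R P K i →ₗ[R] HomCohomology R M (powerTorsionComplex 𝔞 K) i :=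
  Submodule.mapQ _ _ (cocyclesToPowerTorsion π hπ K i) (by
    rintro ⟨f, hf⟩ ⟨k, hk⟩
    refine ⟨powerTorsionLift 𝔞 (π ≫ k) (pow_smul_le_ker_comp hπ _), ?_⟩
    obtain rfl : k ≫ K.d _ i = f := hk
    rfl)

lemma homCohomologyToPowerTorsion_precomp {M P P' : ModuleCat.{u} R} {π : M ⟶ P} {π' : M ⟶ P'}
    (hπ : ∃ n : ℕ, 𝔞 ^ n • (⊤ : Submodule R M) ≤ LinearMap.ker π.hom)
    (hπ' : ∃ n : ℕ, 𝔞 ^ n • (⊤ : Submodule R M) ≤ LinearMap.ker π'.hom)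
    (g : P' ⟶ P) (hg : π' ≫ g = π) (K : CochainComplex (ModuleCat.{u} R) ℕ) (i : ℕ)
    (x : HomCohomology R P K i) :
    homCohomologyToPowerTorsion π' hπ' K i (HomCohomology.precomp g K i x) =
      homCohomologyToPowerTorsion π hπ K i x := by
  subst hg
  obtain ⟨z, rfl⟩ := Submodule.Quotient.mk_surjective _ x
  rfl

/-- The functor `Ext` as the cohomology of `Hom(-, I)`, for an injective resolution `I`. -/
noncomputable def extObjIsoHomCohomology {X : ModuleCat.{u} R} (I : InjectiveResolution X)
    (P : ModuleCat.{u} R) (i : ℕ) :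
    ((_root_.Ext R (ModuleCat.{u} R) i).obj (op P)).obj X ≅
      ModuleCat.of R (HomCohomology R P I.cocomplex i) :=
  extObjIso R P X i ≪≫ (I.homCohomologyEquivExt R P i).symm.toModuleIso

lemma extObjIsoHomCohomology_hom_naturality {X : ModuleCat.{u} R} (I : InjectiveResolution X)
    {P' P : ModuleCat.{u} R} (g : P' ⟶ P) (i : ℕ) :
    ((_root_.Ext R (ModuleCat.{u} R) i).map g.op).app X ≫
        (extObjIsoHomCohomology I P' i).hom =
      (extObjIsoHomCohomology I P i).hom ≫
        ModuleCat.ofHom (HomCohomology.precomp g I.cocomplex i) := by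
  have h := extObjIso_hom_naturality (R := R) g X i
  rw [extObjIsoHomCohomology, extObjIsoHomCohomology, Iso.trans_hom, Iso.trans_hom,
    reassoc_of% h, Category.assoc]
  congr 1
  ext x
  obtain ⟨y, rfl⟩ := (I.homCohomologyEquivExt R P i).surjective x
  have h1 := I.homCohomologyEquivExt_precomp g i y
  change (I.homCohomologyEquivExt R P' i).symm
      ((Ext.mk₀ g).comp (I.homCohomologyEquivExt R P i y) (zero_add i)) =
    HomCohomology.precomp g _ i ((I.homCohomologyEquivExt R P i).symm
      (I.homCohomologyEquivExt R P i y))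
  rw [← h1, LinearEquiv.symm_apply_apply, LinearEquiv.symm_apply_apply]

/-- Filtered colimits of modules are computed on underlying sets, so bijectivity can be tested on
representatives. -/
lemma isIso_colimit_desc {J : Type} [SmallCategory J] [IsFiltered J] {F : J ⥤ ModuleCat.{u} R}
    (c : Cocone F) (hs : ∀ y : c.pt, ∃ j x, c.ι.app j x = y)
    (hi : ∀ j (x : F.obj j), c.ι.app j x = 0 → ∃ (k : J) (f : j ⟶ k), F.map f x = 0) :
    IsIso (colimit.desc F c) := by
  have : PreservesFilteredColimitsOfSize.{0, 0} (forget (ModuleCat.{u} R)) :=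
    preservesFilteredColimitsOfSize_shrink.{0, u, 0, u} _
  have hι (j) (x : F.obj j) : colimit.desc F c (colimit.ι F j x) = c.ι.app j x :=
    ConcreteCategory.congr_hom (colimit.ι_desc c j) x
  refine (ConcreteCategory.isIso_iff_bijective _).2 ⟨?_, fun y ↦ ?_⟩
  · refine (injective_iff_map_eq_zero (colimit.desc F c).hom).2 fun x hx ↦ ?_
    obtain ⟨j, x, rfl⟩ := Concrete.colimit_exists_rep F x
    obtain ⟨k, f, hf⟩ := hi j x ((hι j x).symm.trans hx)
    have := ConcreteCategory.congr_hom (colimit.w F f) x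
    rw [← this, ConcreteCategory.comp_apply, hf, map_zero]
  · obtain ⟨j, x, rfl⟩ := hs y
    exact ⟨_, hι j x⟩

section Colimit

variable {M : ModuleCat.{u} R} {N : ℕᵒᵖ ⥤ ModuleCat.{u} R}
  (π : (Functor.const _).obj M ⟶ N)
  (hπ : ∀ n, LinearMap.ker (π.app n).hom = 𝔞 ^ n.unop • (⊤ : Submodule R M))
  {X : ModuleCat.{u} R} (I : InjectiveResolution X) (i : ℕ)

/-- The cocone which compares the direct limit of the modules `Ext(M / 𝔞 ^ n M, X)` with the
cohomology of `Hom(M, Γ_𝔞(I))`, where `I` is an injective resolution of `X`. -/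
noncomputable def extCocone :
    Cocone ((N.op ⋙ _root_.Ext R (ModuleCat.{u} R) i) ⋙ (evaluation _ _).obj X) where
  pt := ModuleCat.of R (HomCohomology R M (powerTorsionComplex 𝔞 I.cocomplex) i)
  ι :=
    { app n := (extObjIsoHomCohomology I (N.obj n.unop) i).hom ≫ ModuleCat.ofHom
        (homCohomologyToPowerTorsion (π.app n.unop) ⟨_, (hπ n.unop).ge⟩ I.cocomplex i)
      naturality n n' w := by
        refine (Category.assoc _ _ _).symm.trans ((congrArg (· ≫ _)
          (extObjIsoHomCohomology_hom_naturality I (N.map w.unop) i)).trans ?_)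
        rw [Category.assoc]
        refine (congrArg (_ ≫ ·) ?_).trans (Category.comp_id _).symm
        refine ConcreteCategory.hom_ext _ _ fun x ↦ ?_
        have h2 : π.app n'.unop ≫ N.map w.unop = π.app n.unop := by simp [← π.naturality]
        exact homCohomologyToPowerTorsion_precomp _ _ _ h2 _ _ x }

lemma extCocone_ι_app (n : ℕᵒᵖᵒᵖ)
    (x : (((N.op ⋙ _root_.Ext R (ModuleCat.{u} R) i) ⋙ (evaluation _ _).obj X).obj n)) :
    (extCocone π hπ I i).ι.app n x =
      homCohomologyToPowerTorsion (π.app n.unop) ⟨_, (hπ n.unop).ge⟩ I.cocomplex i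
        ((extObjIsoHomCohomology I (N.obj n.unop) i).hom x) := rfl

lemma extObjIsoHomCohomology_hom_surjective (P : ModuleCat.{u} R) :
    Function.Surjective (extObjIsoHomCohomology I P i).hom :=
  (ModuleCat.epi_iff_surjective _).1 inferInstance

variable [∀ n, Epi (π.app n)] [Module.Finite R M]

-- The crux of the limit argument: by finiteness f is killed by some power of 𝔞, hence descends to a
-- late enough quotient. The system `N` is kept abstract to cover both M/𝔞ⁿM and R/𝔞ⁿ.
include hπ in
lemma exists_fac_of_hom_powerTorsion {Q : ModuleCat.{u} R} (f : M ⟶ (powerTorsionFunctor 𝔞).obj Q)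
    (n : ℕ) : ∃ (m : ℕ) (_ : n ≤ m) (g : N.obj (op m) ⟶ Q),
      π.app (op m) ≫ g = f ≫ (powerTorsionι 𝔞).app Q := by
  obtain ⟨m, hm⟩ := exists_pow_smul_le_ker f
  refine ⟨max n m, le_max_left _ _, exists_fac_of_ker_le _ _ ?_⟩
  rw [hπ]
  exact (Submodule.smul_mono_left (Ideal.pow_le_pow_right (le_max_right _ _))).trans hm

lemma exists_extCocone_ι_app_eq
    (y : HomCohomology R M (powerTorsionComplex 𝔞 I.cocomplex) i) :
    ∃ n x, (extCocone π hπ I i).ι.app n x = y := by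
  obtain ⟨f, rfl⟩ := Submodule.Quotient.mk_surjective _ y
  obtain ⟨m, -, g, hg⟩ := exists_fac_of_hom_powerTorsion π hπ (Q := I.cocomplex.X i) f.1 0
  -- The factored map is again a cocycle because the projection from M is epi.
  have hg' : g ≫ I.cocomplex.d i (i + 1) = 0 := by
    rw [← cancel_epi (π.app (op m)), reassoc_of% hg, comp_zero]
    exact congrArg (· ≫ (powerTorsionι 𝔞).app _) f.2
  obtain ⟨x, hx⟩ := extObjIsoHomCohomology_hom_surjective I i (N.obj (op m))
    (Submodule.Quotient.mk ⟨g, hg'⟩)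
  refine ⟨op (op m), x, ?_⟩
  rw [extCocone_ι_app, hx]
  have h : cocyclesToPowerTorsion (𝔞 := 𝔞) (π.app (op m)) ⟨_, (hπ (op m)).ge⟩ I.cocomplex i
      ⟨g, hg'⟩ = f :=
    Subtype.ext ((cancel_mono ((powerTorsionι 𝔞).app (I.cocomplex.X i))).1 hg)
  exact congrArg Submodule.Quotient.mk h

lemma exists_map_eq_zero_of_extCocone_ι_app_eq_zero (n : ℕᵒᵖᵒᵖ)
    (x : (((N.op ⋙ _root_.Ext R (ModuleCat.{u} R) i) ⋙ (evaluation _ _).obj X).obj n))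
    (hx : (extCocone π hπ I i).ι.app n x = 0) :
    ∃ (m : ℕᵒᵖᵒᵖ) (w : n ⟶ m),
      ((N.op ⋙ _root_.Ext R (ModuleCat.{u} R) i) ⋙ (evaluation _ _).obj X).map w x = 0 := by
  rw [extCocone_ι_app] at hx
  obtain ⟨f, hf⟩ := Submodule.Quotient.mk_surjective _
    ((extObjIsoHomCohomology I (N.obj n.unop) i).hom x)
  rw [← hf] at hx
  obtain ⟨g, hg⟩ := (HomCohomology.mk_eq_zero
    (cocyclesToPowerTorsion (π.app n.unop) ⟨_, (hπ n.unop).ge⟩ I.cocomplex i f)).1 hx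
  -- The cochain g that bounds over M itself descends to some stage m ≥ n, where the class therefore
  -- already vanishes.
  obtain ⟨m, hm, k, hk⟩ := exists_fac_of_hom_powerTorsion π hπ
    (Q := I.cocomplex.X ((ComplexShape.up ℕ).prev i)) g n.unop.unop
  let w : op m ⟶ n.unop := (homOfLE hm).op
  refine ⟨op (op m), w.op, ?_⟩
  have hinj : Function.Injective (extObjIsoHomCohomology I (N.obj (op m)) i).hom :=
    (ModuleCat.mono_iff_injective _).1 inferInstance
  refine hinj (Eq.trans ?_ (map_zero (extObjIsoHomCohomology I (N.obj (op m)) i).hom.hom).symm)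
  have h1 := ConcreteCategory.congr_hom
    (extObjIsoHomCohomology_hom_naturality I (N.map w) i) x
  refine h1.trans ?_
  change HomCohomology.precomp (N.map w) I.cocomplex i
    ((extObjIsoHomCohomology I (N.obj n.unop) i).hom x) = 0
  rw [← hf]
  refine (HomCohomology.mk_eq_zero _).2 ⟨k, ?_⟩
  rw [← cancel_epi (π.app (op m))]
  have h2 : π.app (op m) ≫ N.map w = π.app n.unop := by simp [← π.naturality]
  have h3 := congrArg (· ≫ (powerTorsionι 𝔞).app (I.cocomplex.X i)) hg
  have h4 : π.app (op m) ≫ k ≫ I.cocomplex.d _ i = π.app n.unop ≫ f.1 := by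
    rw [reassoc_of% hk]
    exact h3
  refine h4.trans ?_
  rw [← h2, Category.assoc]
  rfl

/-- The direct limit of the modules `Ext(M / 𝔞 ^ n M, X)` is the cohomology of `Hom(M, Γ_𝔞(I))`,
where `I` is an injective resolution of `X`. -/
noncomputable def colimitExtIso :
    (colimit (N.op ⋙ _root_.Ext R (ModuleCat.{u} R) i)).obj X ≅
      ModuleCat.of R (HomCohomology R M (powerTorsionComplex 𝔞 I.cocomplex) i) :=
  have : IsIso (colimit.desc _ (extCocone π hπ I i)) :=
    isIso_colimit_desc (extCocone π hπ I i) (exists_extCocone_ι_app_eq π hπ I i)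
    (exists_map_eq_zero_of_extCocone_ι_app_eq_zero π hπ I i)
  colimitObjIsoColimitCompEvaluation _ _ ≪≫
    @asIso _ _ _ _ (colimit.desc _ (extCocone π hπ I i)) this

end Colimit

end ModuleCat

/-! ### Complexes of injectives: dimension shifting along the cycles. -/

namespace CategoryTheory

open Limits Abelian

section ComplexOfInjectives

variable {C : Type u} [Category.{v} C] [Abelian C] (J : CochainComplex C ℕ)

/-- The short exact sequence relating the cycles in consecutive degrees of a complex. -/
noncomputable abbrev _root_.CochainComplex.cyclesShortComplex (n : ℕ) : ShortComplex C :=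
  ShortComplex.mk (J.iCycles n) (J.toCycles n (n + 1)) (by
    rw [← cancel_mono (J.iCycles (n + 1)), Category.assoc, J.toCycles_i, J.iCycles_d, zero_comp])

/-- Exactness in degree n + 1 serves only to make Jⁿ → Zⁿ⁺¹ epi; the rest holds for every complex.
-/
lemma _root_.CochainComplex.cyclesShortComplex_shortExact {n : ℕ} (h : J.ExactAt (n + 1)) :
    (J.cyclesShortComplex n).ShortExact where
  exact := by
    refine ShortComplex.exact_of_f_is_kernel _ (KernelFork.IsLimit.ofι' _ _ fun k hk ↦ ?_)
    have hk' : k ≫ J.d n (n + 1) = 0 := by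
      rw [← J.toCycles_i n (n + 1)]
      exact (Category.assoc _ _ _).symm.trans ((congrArg (· ≫ _) hk).trans zero_comp)
    exact ⟨J.liftCycles k (n + 1) (by simp) hk', J.liftCycles_i _ _ _ _⟩
  mono_f := inferInstanceAs (Mono (J.iCycles n))
  epi_g := by
    have hex : (ShortComplex.mk _ _ (J.toCycles_comp_homologyπ n (n + 1))).Exact :=
      ShortComplex.exact_of_g_is_cokernel _ (J.homologyIsCokernel n (n + 1) (by simp))
    exact hex.epi_f ((HomologicalComplex.exactAt_iff_isZero_homology _ _).1 h |>.eq_of_tgt _ _)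

/-- The short exact sequence relating boundaries, cycles and homology. -/
noncomputable abbrev _root_.CochainComplex.homologyShortComplex (n : ℕ) : ShortComplex C :=
  ShortComplex.mk (kernel.ι (J.homologyπ n)) (J.homologyπ n) (kernel.condition _)

lemma _root_.CochainComplex.homologyShortComplex_shortExact (n : ℕ) :
    (J.homologyShortComplex n).ShortExact where
  exact := ShortComplex.exact_kernel _
  mono_f := inferInstanceAs (Mono (kernel.ι _))
  epi_g := inferInstanceAs (Epi (J.homologyπ n))

variable {M : C} {R : Type*} [CommRing R] [Linear R C]

/-- A cocycle of `Hom(M, J)` as a morphism to the cycles of `J`. -/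
noncomputable def homCocyclesEquiv (R : Type*) [CommRing R] [Linear R C] (M : C) (n : ℕ) :
    homCocycles R M J n ≃ₗ[R] (M ⟶ J.cycles n) :=
  LinearEquiv.symm <| LinearEquiv.ofBijective
    ((Linear.rightComp R M (J.iCycles n)).codRestrict _ fun f ↦ by
      rw [mem_homCocycles, Linear.rightComp_apply, Category.assoc, J.iCycles_d, comp_zero]) (by
    constructor
    · intro f g h
      exact (cancel_mono (J.iCycles n)).1 (congrArg Subtype.val h)
    · rintro ⟨f, hf⟩
      exact ⟨J.liftCycles f (n + 1) (by simp) hf, Subtype.ext (J.liftCycles_i _ _ _ _)⟩)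

lemma homCocyclesEquiv_iCycles (n : ℕ) (z : homCocycles R M J n) :
    homCocyclesEquiv J R M n z ≫ J.iCycles n = z.1 :=
  congrArg Subtype.val ((homCocyclesEquiv J R M n).symm_apply_apply z)

lemma homCohomology_mk_eq_zero_iff (n : ℕ) (z : homCocycles R M J n) :
    (Submodule.Quotient.mk z : HomCohomology R M J n) = 0 ↔
      ∃ g, g ≫ J.toCycles ((ComplexShape.up ℕ).prev n) n = homCocyclesEquiv J R M n z := by
  rw [HomCohomology.mk_eq_zero]
  refine exists_congr fun g ↦ ?_
  rw [← cancel_mono (J.iCycles n), homCocyclesEquiv_iCycles, Category.assoc, J.toCycles_i]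

/-- A surjective linear map on cocycles which vanishes precisely on the coboundaries identifies
the cohomology of `Hom(M, J)`. -/
noncomputable def homCohomologyEquivOfSurjective {n : ℕ} {E : Type*} [AddCommGroup E] [Module R E]
    (φ : (M ⟶ J.cycles n) →ₗ[R] E) (hs : Function.Surjective φ)
    (h0 : ∀ f, φ f = 0 ↔ ∃ g, g ≫ J.toCycles ((ComplexShape.up ℕ).prev n) n = f) :
    HomCohomology R M J n ≃ₗ[R] E :=
  have hz (z : homCocycles R M J n) : φ (homCocyclesEquiv J R M n z) = 0 ↔
      (Submodule.Quotient.mk z : HomCohomology R M J n) = 0 :=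
    (h0 _).trans (homCohomology_mk_eq_zero_iff J n z).symm
  LinearEquiv.ofBijective
    (Submodule.liftQ _ (φ ∘ₗ (homCocyclesEquiv J R M n).toLinearMap) fun z hz' ↦
      (hz z).2 ((Submodule.Quotient.mk_eq_zero _).2 hz')) (by
    constructor
    · refine (injective_iff_map_eq_zero _).2 fun x hx ↦ ?_
      obtain ⟨z, rfl⟩ := Submodule.Quotient.mk_surjective _ x
      exact (hz z).1 hx
    · intro e
      obtain ⟨f, rfl⟩ := hs e
      obtain ⟨z, rfl⟩ := (homCocyclesEquiv J R M n).surjective f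
      exact ⟨Submodule.Quotient.mk z, rfl⟩)

variable [∀ n, Injective (J.X n)] [HasExt.{w} C]

/-- The boundaries, realised as the kernel of Z → H, are a quotient q of an injective. As Extᵖ⁺²
from M vanishes, every class lifts along q to Extᵖ⁺¹(M, injective), which is zero because p + 1 > 0.
-/
lemma ext_boundaries_eq_zero {p : ℕ} [HasProjectiveDimensionLT M (p + 2)] (n : ℕ)
    (e : Ext M (kernel (J.homologyπ n)) (p + 1)) : e = 0 := by
  have hex : (ShortComplex.mk _ _
      (J.toCycles_comp_homologyπ ((ComplexShape.up ℕ).prev n) n)).Exact :=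
    ShortComplex.exact_of_g_is_cokernel _ (J.homologyIsCokernel _ n rfl)
  let q : J.X ((ComplexShape.up ℕ).prev n) ⟶ kernel (J.homologyπ n) :=
    kernel.lift _ _ (J.toCycles_comp_homologyπ ((ComplexShape.up ℕ).prev n) n)
  have hq : Epi q := hex.epi_kernelLift
  have hS : (ShortComplex.mk _ _ (kernel.condition q)).ShortExact :=
    { exact := ShortComplex.exact_kernel _
      mono_f := inferInstanceAs (Mono (kernel.ι _))
      epi_g := hq }
  obtain ⟨x, rfl⟩ := Ext.covariant_sequence_exact₃ M hS e (n₁ := p + 2) rfl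
    (Ext.eq_zero_of_hasProjectiveDimensionLT _ (p + 2) le_rfl)
  rw [Ext.eq_zero_of_injective x, Ext.zero_comp]

/-- `Ext` in top degree does not distinguish the cycles and the homology of a complex of
injective objects. -/
noncomputable def extCyclesEquivExtHomology {p : ℕ} [HasProjectiveDimensionLT M (p + 2)] (n : ℕ) :
    Ext M (J.cycles n) (p + 1) ≃ₗ[R] Ext M (J.homology n) (p + 1) :=
  LinearEquiv.ofBijective ((Ext.mk₀ (J.homologyπ n)).postcompOfLinear R M (add_zero _)) (by
    constructor
    · refine (injective_iff_map_eq_zero _).2 fun x hx ↦ ?_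
      obtain ⟨y, rfl⟩ := Ext.covariant_sequence_exact₂ M (J.homologyShortComplex_shortExact n) x hx
      rw [ext_boundaries_eq_zero J n y, Ext.zero_comp]
    · intro x
      exact Ext.covariant_sequence_exact₃ M (J.homologyShortComplex_shortExact n) x
        (n₁ := p + 2) rfl (Ext.eq_zero_of_hasProjectiveDimensionLT _ (p + 2) le_rfl))

/-- Dimension shifting along the short exact sequence of cycles. -/
noncomputable def extCyclesSuccEquiv {n : ℕ} (h : J.ExactAt (n + 1)) (k : ℕ) :
    Ext M (J.cycles (n + 1)) (k + 1) ≃ₗ[R] Ext M (J.cycles n) (k + 2) :=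
  LinearEquiv.ofBijective
    ((J.cyclesShortComplex_shortExact h).extClass.postcompOfLinear R M rfl) (by
    constructor
    · refine (injective_iff_map_eq_zero _).2 fun x hx ↦ ?_
      obtain ⟨y, rfl⟩ := Ext.covariant_sequence_exact₃ M (J.cyclesShortComplex_shortExact h) x
        rfl hx
      have : Injective (J.cyclesShortComplex n).X₂ := inferInstanceAs (Injective (J.X n))
      rw [Ext.eq_zero_of_injective y, Ext.zero_comp]
    · intro x
      have : Injective (J.cyclesShortComplex n).X₂ := inferInstanceAs (Injective (J.X n))
      exact Ext.covariant_sequence_exact₁ M (J.cyclesShortComplex_shortExact h) x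
        (Ext.eq_zero_of_injective _) rfl)

/-- The first cohomology of `Hom(M, J)` past a degree as an `Ext`-module. -/
noncomputable def homCohomologySuccEquivExt {n : ℕ} (h : J.ExactAt (n + 1)) :
    HomCohomology R M J (n + 1) ≃ₗ[R] Ext M (J.cycles n) 1 :=
  -- The connecting map Hom(M, Zⁿ⁺¹) → Ext¹(M, Zⁿ) is onto since Jⁿ is injective, and its kernel
  -- consists of the maps that lift to Jⁿ, that is, the coboundaries.
  homCohomologyEquivOfSurjective J
    ((J.cyclesShortComplex_shortExact h).extClass.postcompOfLinear R M (zero_add 1) ∘ₗ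
      Ext.linearEquiv₀.symm.toLinearMap)
    (by
      intro x
      have : Injective (J.cyclesShortComplex n).X₂ := inferInstanceAs (Injective (J.X n))
      obtain ⟨y, rfl⟩ := Ext.covariant_sequence_exact₁ M (J.cyclesShortComplex_shortExact h) x
        (Ext.eq_zero_of_injective _) (zero_add 1)
      obtain ⟨f, rfl⟩ := (Ext.linearEquiv₀ (R := R)).symm.surjective y
      exact ⟨f, rfl⟩)
    (by
      intro f
      rw [CochainComplex.prev_nat_succ]
      constructor
      · intro hf
        obtain ⟨g, hg⟩ := Ext.covariant_sequence_exact₃ M (J.cyclesShortComplex_shortExact h)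
          _ (zero_add 1) hf
        obtain ⟨g, rfl⟩ := (Ext.linearEquiv₀ (R := R)).symm.surjective g
        refine ⟨g, (Ext.linearEquiv₀ (R := R)).symm.injective ?_⟩
        exact (Ext.mk₀_comp_mk₀ _ _).symm.trans hg
      · rintro ⟨g, rfl⟩
        change ((Ext.mk₀ (g ≫ J.toCycles n (n + 1))).comp
          (J.cyclesShortComplex_shortExact h).extClass (zero_add 1)) = 0
        rw [← Ext.mk₀_comp_mk₀, Ext.comp_assoc_of_second_deg_zero,
          (J.cyclesShortComplex_shortExact h).comp_extClass, Ext.comp_zero])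

/-- If a complex `J` of injectives is exact in degrees `> c`, the cohomology of `Hom(M, J)` in
degrees `> c` is given by `Ext` with values in the cycles of degree `c`. -/
lemma nonempty_homCohomology_equiv_ext_cycles {c : ℕ} (h : ∀ i, c < i → J.ExactAt i) (k n : ℕ)
    (hn : c + k + 1 = n) :
    Nonempty (HomCohomology R M J n ≃ₗ[R] Ext M (J.cycles c) (k + 1)) := by
  subst hn
  induction k generalizing c with
  | zero => exact ⟨homCohomologySuccEquivExt J (h _ (Nat.lt_succ_self c))⟩
  | succ k ih =>
    -- The total degree stays fixed: start from Zᶜ⁺¹, then trade it for Zᶜ at the cost of one `Ext`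
    -- degree.
    obtain ⟨e⟩ := ih (c := c + 1) fun i hi ↦ h i ((Nat.lt_succ_self c).trans hi)
    rw [show c + (k + 1) + 1 = c + 1 + k + 1 by omega]
    exact ⟨e.trans (extCyclesSuccEquiv J (h _ (Nat.lt_succ_self c)) k)⟩

/-- Over a projective object, `Hom(M, -)` commutes with cohomology. -/
noncomputable def homCohomologyEquivExtOfProjective [Projective M] (n : ℕ) :
    HomCohomology R M J n ≃ₗ[R] Ext M (J.homology n) 0 :=
  (homCohomologyEquivOfSurjective J (Linear.rightComp R M (J.homologyπ n))
    (fun f ↦ ⟨Projective.factorThru f (J.homologyπ n), Projective.factorThru_comp _ _⟩)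
    (by
      intro f
      have hex : (ShortComplex.mk _ _
          (J.toCycles_comp_homologyπ ((ComplexShape.up ℕ).prev n) n)).Exact :=
        ShortComplex.exact_of_g_is_cokernel _ (J.homologyIsCokernel _ n rfl)
      constructor
      · intro hf
        exact ⟨hex.liftFromProjective f hf, hex.liftFromProjective_comp f hf⟩
      · rintro ⟨g, rfl⟩
        rw [Linear.rightComp_apply, Category.assoc, J.toCycles_comp_homologyπ, comp_zero])).trans
    Ext.linearEquiv₀.symm

/-- Let `J` be a complex of injectives which is exact in degrees `> c` and `M` be of projective
dimension `≤ p`. Then the cohomology of `Hom(M, J)` in degree `p + c` is `Ext^p(M, H^c(J))`. -/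
theorem nonempty_homCohomology_add_equiv_ext {c : ℕ} (h : ∀ i, c < i → J.ExactAt i) (p : ℕ)
    [HasProjectiveDimensionLT M (p + 1)] :
    Nonempty (HomCohomology R M J (p + c) ≃ₗ[R] Ext M (J.homology c) p) := by
  cases p with
  -- Degree c itself is not past c, so the dimension shift is unavailable and projectivity of M
  -- replaces it.
  | zero =>
    rw [zero_add]
    have : Projective M := projective_iff_hasProjectiveDimensionLT_one.2 ‹_›
    exact ⟨homCohomologyEquivExtOfProjective J c⟩
  | succ k =>
    obtain ⟨e⟩ := nonempty_homCohomology_equiv_ext_cycles (R := R) (M := M) J h k (k + 1 + c)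
      (by omega)
    exact ⟨e.trans (extCyclesEquivExtHomology J c)⟩

/-- Dimension shifting turns this into `Ext` from M in degree i - c > p with values in Zᶜ. -/
theorem subsingleton_homCohomology_of_add_lt {c : ℕ} (h : ∀ i, c < i → J.ExactAt i) (p : ℕ)
    [HasProjectiveDimensionLT M (p + 1)] (i : ℕ) (hi : p + c < i) :
    Subsingleton (HomCohomology R M J i) := by
  obtain ⟨k, rfl⟩ := Nat.exists_eq_add_of_lt hi
  obtain ⟨e⟩ := nonempty_homCohomology_equiv_ext_cycles (R := R) (M := M) J h (p + k)
    (p + c + k + 1) (by omega)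
  have := HasProjectiveDimensionLT.subsingleton M (p + 1) (p + k + 1) (by omega) (J.cycles c)
  exact e.toEquiv.subsingleton

/-- If `J` is an acyclic complex of injectives in non-negative degrees, `Hom(M, J)` is acyclic. -/
theorem subsingleton_homCohomology_of_acyclic (h : ∀ i, J.ExactAt i) (i : ℕ) :
    Subsingleton (HomCohomology R M J i) := by
  -- Nothing maps into degree 0, so Z⁰ = H⁰, and H⁰ = 0 by acyclicity; shifting down to Z⁰ then
  -- settles all positive degrees.
  have h0 : IsZero (J.cycles 0) := by
    have hm : Mono (J.homologyπ 0) := by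
      have hex : (ShortComplex.mk _ _
          (J.toCycles_comp_homologyπ ((ComplexShape.up ℕ).prev 0) 0)).Exact :=
        ShortComplex.exact_of_g_is_cokernel _ (J.homologyIsCokernel _ 0 rfl)
      refine hex.mono_g ?_
      rw [← cancel_mono (J.iCycles 0)]
      simp
    exact ((HomologicalComplex.exactAt_iff_isZero_homology _ _).1 (h 0)).of_mono (J.homologyπ 0)
  cases i with
  | zero =>
    have : Subsingleton (M ⟶ J.cycles 0) := ⟨fun f g ↦ h0.eq_of_tgt f g⟩
    have := (homCocyclesEquiv J R M 0).toEquiv.subsingleton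
    exact (Submodule.Quotient.mk_surjective _).subsingleton
  | succ k =>
    obtain ⟨e⟩ := nonempty_homCohomology_equiv_ext_cycles (R := R) (M := M) J (c := 0)
      (fun i _ ↦ h i) k (k + 1) (by omega)
    have : Injective (J.cycles 0) := h0.injective
    have : Subsingleton (Ext M (J.cycles 0) (k + 1)) :=
      ⟨fun x y ↦ (Ext.eq_zero_of_injective x).trans (Ext.eq_zero_of_injective y).symm⟩
    exact e.toEquiv.subsingleton

end ComplexOfInjectives

end CategoryTheory

/-! ### Local cohomology through Γ_𝔞(I), and the theorem. -/

namespace ModuleCat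

open Limits Abelian Opposite

variable {R : Type u} [CommRing R] (𝔞 : Ideal R)

/-- The projections from `M` to the quotients `M / 𝔞 ^ n M`. -/
def quotientPowersCone (M : ModuleCat.{u} R) :
    (Functor.const _).obj M ⟶ quotientPowersDiagram 𝔞 M where
  app n := ModuleCat.ofHom (𝔞 ^ n.unop • ⊤ : Submodule R M).mkQ

instance (M : ModuleCat.{u} R) (n : ℕᵒᵖ) : Epi ((quotientPowersCone 𝔞 M).app n) :=
  (ModuleCat.epi_iff_surjective _).2 (Submodule.mkQ_surjective _)

/-- The projections from `R` to the quotients `R / 𝔞 ^ n`. -/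
def ringModPowersCone :
    (Functor.const _).obj (ModuleCat.of R R) ⟶
      localCohomology.ringModIdeals (localCohomology.idealPowersDiagram 𝔞) where
  app n := ModuleCat.ofHom (𝔞 ^ n.unop : Submodule R R).mkQ

instance (n : ℕᵒᵖ) : Epi ((ringModPowersCone 𝔞).app n) :=
  (ModuleCat.epi_iff_surjective _).2 (Submodule.mkQ_surjective _)

/-- Morphisms out of `R` are elements. -/
def homOfSelfEquiv (K : ModuleCat.{u} R) : (ModuleCat.of R R ⟶ K) ≃ₗ[R] K :=
  ModuleCat.homLinearEquiv.trans (LinearMap.ringLmapEquivSelf R R K)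

variable {X : ModuleCat.{u} R} (I : InjectiveResolution X) (i : ℕ)

/-- Generalized local cohomology in terms of an injective resolution. -/
noncomputable def generalizedLocalCohomologyObjIso (M : ModuleCat.{u} R) [Module.Finite R M] :
    (generalizedLocalCohomology 𝔞 i M).obj X ≅
      ModuleCat.of R (HomCohomology R M (powerTorsionComplex 𝔞 I.cocomplex) i) :=
  colimitExtIso (quotientPowersCone 𝔞 M) (fun _ ↦ Submodule.ker_mkQ _) I i

instance [IsNoetherianRing R] (n : ℕ) : Injective ((powerTorsionComplex 𝔞 I.cocomplex).X n) :=
  inferInstanceAs (Injective ((powerTorsionFunctor 𝔞).obj (I.cocomplex.X n)))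

/-- Local cohomology is the cohomology of `Γ_𝔞(I)` for an injective resolution `I`. -/
noncomputable def localCohomologyObjIso [IsNoetherianRing R] :
    (localCohomology 𝔞 i).obj X ≅ (powerTorsionComplex 𝔞 I.cocomplex).homology i :=
  have : Module.Finite R (ModuleCat.of R R) := inferInstanceAs (Module.Finite R R)
  have : Projective (ModuleCat.of R R) :=
    (IsProjective.iff_projective (R := R) R).1 inferInstance
  -- The case M = R: since R is projective, the cohomology of Hom(R, J) is Hom(R, H(J)), which is
  -- H(J).
  colimitExtIso (ringModPowersCone 𝔞) (fun _ ↦ by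
    refine (Submodule.ker_mkQ _).trans ?_
    exact (Ideal.mul_top _).symm) I i ≪≫
  ((homCohomologyEquivExtOfProjective (powerTorsionComplex 𝔞 I.cocomplex) i).trans
    (Ext.linearEquiv₀.trans (homOfSelfEquiv _))).toModuleIso

lemma exactAt_powerTorsionComplex_iff [IsNoetherianRing R] :
    (powerTorsionComplex 𝔞 I.cocomplex).ExactAt i ↔
      IsZero ((localCohomology 𝔞 i).obj X) := by
  rw [HomologicalComplex.exactAt_iff_isZero_homology]
  exact (localCohomologyObjIso 𝔞 I i).isZero_iff.symm

variable (X) in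
lemma isZero_localCohomology_of_cohomologicalDimension_lt
    (h : cohomologicalDimension 𝔞 X < i) : IsZero ((localCohomology 𝔞 i).obj X) := by
  by_contra hi
  exact not_le_of_gt h (le_sSup ⟨i, rfl, hi⟩)

end ModuleCat

lemma WithBot.enat_cases (d : WithBot ℕ∞) : d = ⊥ ∨ (∃ n : ℕ, d = n) ∨ d = ⊤ := by
  induction d with
  | bot => exact Or.inl rfl
  | coe d =>
    induction d with
    | top => exact Or.inr (Or.inr rfl)
    | coe n => exact Or.inr (Or.inl ⟨n, rfl⟩)

open ModuleCat Limits

theorem proposition2p8 {R : Type u} [CommRing R] [IsNoetherianRing R] (𝔞 : Ideal R)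
    (M X : ModuleCat.{u} R) [Module.Finite R M] (hM : projectiveDimension M < ⊤) :
    (∀ i : ℕ, projectiveDimension M + cohomologicalDimension 𝔞 X < i →
      Limits.IsZero ((generalizedLocalCohomology 𝔞 i M).obj X)) ∧
    (∀ p c : ℕ, projectiveDimension M = p → cohomologicalDimension 𝔞 X = c →
      Nonempty ((generalizedLocalCohomology 𝔞 (p + c) M).obj X ≅
        ((Ext R (ModuleCat.{u} R) p).obj (Opposite.op M)).obj
          ((localCohomology 𝔞 c).obj X))) := by
  let I := injectiveResolution X
  have hc (c : ℕ) (h : cohomologicalDimension 𝔞 X = c) (i : ℕ) (hi : c < i) :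
      (powerTorsionComplex 𝔞 I.cocomplex).ExactAt i := by
    rw [exactAt_powerTorsionComplex_iff]
    refine isZero_localCohomology_of_cohomologicalDimension_lt 𝔞 X i ?_
    rw [h]
    exact_mod_cast hi
  have hp (p : ℕ) (h : projectiveDimension M = p) : HasProjectiveDimensionLT M (p + 1) :=
    (projectiveDimension_le_iff M p).1 h.le
  constructor
  · intro i hi
    refine IsZero.of_iso (@ModuleCat.isZero_of_subsingleton _ _ (ModuleCat.of R _) ?_)
      (generalizedLocalCohomologyObjIso 𝔞 I i M)
    obtain hpb | ⟨p, hpd⟩ | hpt := WithBot.enat_cases (projectiveDimension M)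
    -- pd(M) = -∞ means M = 0.
    · have hM0 := (projectiveDimension_eq_bot_iff M).1 hpb
      have : Subsingleton (M ⟶ (powerTorsionComplex 𝔞 I.cocomplex).X i) :=
        ⟨fun f g ↦ hM0.eq_of_src f g⟩
      exact (Submodule.Quotient.mk_surjective _).subsingleton
    · have := hp p hpd
      obtain hcb | ⟨c, hcd⟩ | hct := WithBot.enat_cases (cohomologicalDimension 𝔞 X)
      -- cd = -∞ means that Γ_𝔞(I) is acyclic, and then no bound on i is needed.
      · refine subsingleton_homCohomology_of_acyclic _ (fun j ↦ ?_) i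
        rw [exactAt_powerTorsionComplex_iff]
        refine isZero_localCohomology_of_cohomologicalDimension_lt 𝔞 X j ?_
        rw [hcb]
        exact WithBot.bot_lt_coe _
      · refine subsingleton_homCohomology_of_add_lt _ (hc c hcd) p i ?_
        rw [hpd, hcd] at hi
        exact_mod_cast hi
      -- For cd = ∞ the sum is ∞ and no i exceeds it.
      · rw [hpd, hct] at hi
        exact absurd hi (not_lt_of_ge le_top)
    · exact absurd hM (hpt ▸ lt_irrefl _)
  · intro p c hpd hcd
    have := hp p hpd
    obtain ⟨e⟩ := nonempty_homCohomology_add_equiv_ext (R := R) (M := M)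
      (powerTorsionComplex 𝔞 I.cocomplex) (hc c hcd) p
    exact ⟨generalizedLocalCohomologyObjIso 𝔞 I (p + c) M ≪≫ e.toModuleIso ≪≫
      (extObjIso R M _ p).symm ≪≫
      ((Ext R (ModuleCat.{u} R) p).obj (Opposite.op M)).mapIso (localCohomologyObjIso 𝔞 I c).symm⟩
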